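/- Let $\mathbb H$ be the upper half-plane with the measure $d\mu=y^{-2}\,dx\,dy$, let $\mathcal D=\{z\in\mathbb H: |z|\ge 1,\ |\mathrm{Re}\, z|\le \tfrac12\}$ be the standard fundamental domain of $SL_2(\mathbb Z)$, and let $Y_0(M)=\Gamma_0(M)\backslash\mathbb H$. For $\Gamma_0(M)$-invariant $f,g$ write $\langle f,g\rangle_M=\int_{Y_0(M)} f\,\overline g\,d\mu$. For $z=x+iy\in\mathbb H$ let $E(z,s)=\frac12\sum_{(c,d)=1}\frac{y^s}{|cz+d|^{2s}}$ ($\mathrm{Re}\, s>1$, $(c,d)$ running over pairs of coprime integers), continued meromorphically to a neighbourhood of $s=1$. Let $G(z)$ be the constant term of its Laurent expansion at $s=1$ (which exists for every $z$), and put $G|_M(z)=G(Mz)$. For a prime $M$ let $$c_1=c_M=\frac{\zeta(2)}{L(2,\chi_{0,M})}\bigl(M^{-1}-M^{-2}\bigr),$$ where $\chi_{0,M}$ is the principal character modulo $M$. Let $\phi_0:\mathbb H\to\mathbb C$ be smooth and $SL_2(\mathbb Z)$-invariant, and suppose that the part of its support lying in $\mathcal D$ is compact, connected, non-empty, and contained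 in the interior of $\mathcal D$. Put $\|\phi_0\|_1=\int_{\mathcal D}|\phi_0|\,d\mu$. Let $SL_2(\mathbb Z)=\bigsqcup_{j=1}^{\nu(M)}\Gamma_0(M)\gamma_j$ be the decomposition into cosets. The test functions $\phi_1^{(M)},\dots,\phi_{\nu(M)}^{(M)}$ are the $\Gamma_0(M)$-invariant functions on $\mathbb H$ such that $\phi_j^{(M)}$ agrees with $\phi_0$ on $\bigcup_{g\in\Gamma_0(M)} g\gamma_j\mathcal D$ and vanishes elsewhere. **Theorem.** There is an absolute constant $\delta>0$ such that for every $Y$ there is a constant $C=C(Y)>0$ with the following property. For every $\phi_0$ as above whose support within $\mathcal D$ lies in $\{\mathrm{Im}\, z\le Y\}$, and for every prime $M$, at least $\delta M$ of the test functions $\phi=\phi_j^{(M)}$ are such that the integrals $\langle G,\phi\rangle_M$ and $\langle G|_M,\phi\rangle_M$ converge absolutely and $$|c_1|\,|\langle G,\phi\rangle_M|+|c_M|\,|\langle G|_M,\phi\rangle_M|\le C\,M^{-1}\,\|\phi_0\|_1 .$$ (For these test functions the two potentially large terms of the main term are $O(M^{-1}\|\phi_0\|_1)$, which is what is meant by saying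 that they satisfy the quantum unique ergodicity conjecture on shrinking sets.) -/

import Mathlib

open scoped MatrixGroups UpperHalfPlane Modular Manifold ContDiff Topology ComplexConjugate

namespace ShrinkingQUE

open MeasureTheory Filter CongruenceSubgroup

noncomputable section

/-! ### The Eisenstein series of level one and its Laurent expansion at `s = 1` -/

/-- `E(z, s) = (1/2) ∑_{gcd(c, d) = 1} y ^ s / |c z + d| ^ (2 s)`, for `Re s > 1`. -/
def eisensteinE (z : ℍ) (s : ℂ) : ℂ :=
  (1 / 2) * ∑' p : {p : ℤ × ℤ // IsCoprime p.1 p.2},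
    ((z.im : ℝ) : ℂ) ^ s / ((‖((p.1.1 : ℂ) * (z : ℂ) + (p.1.2 : ℂ))‖ : ℝ) : ℂ) ^ (2 * s)

/-- `A` is the constant term of the Laurent expansion of `f` at `a`: the function `f` is
meromorphic at `a` and `f s = P (1 / (s - a)) + o (1)` as `s → a`, where `P` is a polynomial
with constant coefficient `A`. -/
def IsLaurentConstantTerm (f : ℂ → ℂ) (a A : ℂ) : Prop :=
  MeromorphicAt f a ∧ ∃ P : Polynomial ℂ, P.coeff 0 = A ∧
    Tendsto (fun s => f s - P.eval (s - a)⁻¹) (𝓝[≠] a) (𝓝 0)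

/-- `A` is the constant term of the Laurent expansion at `s = 1` of (the meromorphic continuation
of) `E(z, s)`. -/
def IsEisensteinConstantTerm (z : ℍ) (A : ℂ) : Prop :=
  ∃ F : ℂ → ℂ, (∀ s : ℂ, 1 < s.re → F s = eisensteinE z s) ∧ IsLaurentConstantTerm F 1 A

/-- The constant term does not depend on any choice. -/
theorem IsEisensteinConstantTerm.unique {z : ℍ} {A B : ℂ} (hA : IsEisensteinConstantTerm z A)
    (hB : IsEisensteinConstantTerm z B) : A = B := by
  obtain ⟨F, hF, hFm, P, rfl, hP⟩ := hA
  obtain ⟨H, hH, hHm, Q, rfl, hQ⟩ := hB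
  have hfreq : ∃ᶠ s in 𝓝[≠] (1 : ℂ), F s = H s := by
    have ht : Tendsto (fun t : ℝ => ((1 + t : ℝ) : ℂ)) (𝓝[>] 0) (𝓝[≠] (1 : ℂ)) := by
      refine tendsto_nhdsWithin_iff.2 ⟨?_, ?_⟩
      · have : Continuous (fun t : ℝ => ((1 + t : ℝ) : ℂ)) := by fun_prop
        have h := this.tendsto 0
        simp only [add_zero, Complex.ofReal_one] at h
        exact h.mono_left nhdsWithin_le_nhds
      · filter_upwards [self_mem_nhdsWithin] with t ht
        have : (0 : ℝ) < t := ht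
        simp [this.ne']
    refine ht.frequently (Eventually.frequently ?_)
    filter_upwards [self_mem_nhdsWithin] with t ht
    have h0 : (0 : ℝ) < t := ht
    have h1 : 1 < ((1 + t : ℝ) : ℂ).re := by rw [Complex.ofReal_re]; linarith
    rw [hF _ h1, hH _ h1]
  have heq := (hFm.frequently_eq_iff_eventuallyEq hHm).1 hfreq
  have hdiff : Tendsto (fun s : ℂ => (Q - P).eval (s - 1)⁻¹) (𝓝[≠] (1 : ℂ)) (𝓝 0) := by
    have h := hP.sub hQ
    rw [sub_zero] at h
    refine h.congr' ?_
    filter_upwards [heq] with s hs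
    rw [hs, Polynomial.eval_sub]
    ring
  have hinv : Tendsto (fun w : ℂ => w⁻¹ + 1) (Bornology.cobounded ℂ) (𝓝[≠] (1 : ℂ)) := by
    refine tendsto_nhdsWithin_iff.2 ⟨?_, ?_⟩
    · simpa using (tendsto_inv₀_cobounded (α := ℂ)).add_const 1
    · filter_upwards [Bornology.eventually_ne_cobounded (0 : ℂ)] with w hw
      simpa using hw
  have hcob : Tendsto (fun w : ℂ => (Q - P).eval w) (Bornology.cobounded ℂ) (𝓝 0) := by
    refine (hdiff.comp hinv).congr fun w => ?_
    simp
  have hzero : Q - P = 0 := by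
    by_contra hne
    rcases Nat.eq_zero_or_pos (Q - P).natDegree with hd | hd
    · rw [Polynomial.natDegree_eq_zero] at hd
      obtain ⟨c, hc⟩ := hd
      rw [← hc] at hcob hne
      simp only [Polynomial.eval_C, tendsto_const_nhds_iff] at hcob
      exact hne (by rw [hcob, Polynomial.C_0])
    · have h := Polynomial.tendsto_norm_atTop (Q - P)
        (Polynomial.natDegree_pos_iff_degree_pos.1 hd)
        (tendsto_norm_cobounded_atTop (E := ℂ))
      exact not_tendsto_atTop_of_tendsto_nhds hcob.norm h
  rw [sub_eq_zero.1 hzero]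

/-- `G(z)`, the constant term of the Laurent expansion of `E(z, s)` at `s = 1`. -/
def eisensteinG (z : ℍ) : ℂ := Classical.epsilon (IsEisensteinConstantTerm z)

/-- For `f` on the upper half-plane, `f|_M (z) = f (M z)`. -/
def dilate (M : ℕ) [NeZero M] (f : ℍ → ℂ) (z : ℍ) : ℂ :=
  f ((⟨(M : ℝ), Nat.cast_pos.2 (NeZero.pos M)⟩ : {x : ℝ // 0 < x}) • z)

/-! ### Integration over `Y_0(M)`

The measure `volume` on `ℍ` is `y ^ (-2) dx dy`, the set `𝒟` is the standard fundamental domain of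
`SL(2, ℤ)`, and `𝒟ᵒ` is its interior. -/

/-- The right cosets `Γ_0(M) γ` in `SL(2, ℤ)`. -/
abbrev RightCosets (M : ℕ) : Type := Quotient (QuotientGroup.rightRel (Gamma0 M))

instance (M : ℕ) [NeZero M] : Finite (RightCosets M) :=
  Finite.of_equiv _ (QuotientGroup.quotientRightRelEquivQuotientLeftRel (Gamma0 M)).symm

/-- The integral over `Y_0(M)` of a `Γ_0(M)`-invariant function: the integral over the fundamental
domain `⋃ γ 𝒟` of `Γ_0(M)`, where `γ` runs over representatives of the cosets `Γ_0(M) γ`. -/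
def integralY0 (M : ℕ) (f : ℍ → ℂ) : ℂ :=
  ∑ᶠ q : RightCosets M, ∫ z in 𝒟, f (q.out • z)

/-- Integrability over `Y_0(M)` of a `Γ_0(M)`-invariant function. -/
def IntegrableY0 (M : ℕ) (f : ℍ → ℂ) : Prop :=
  ∀ q : RightCosets M, IntegrableOn (fun z => f (q.out • z)) 𝒟

/-- `⟨f, g⟩_M`, the integral of `f` times the conjugate of `g` over `Y_0(M)`. -/
def innerY0 (M : ℕ) (f g : ℍ → ℂ) : ℂ := integralY0 M fun z => f z * conj (g z)

/-- `‖f‖_1`, the integral of `|f|` over `Y_0(1)`. -/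
def normL1 (f : ℍ → ℂ) : ℝ := ∫ z in 𝒟, ‖f z‖

/-! ### The test functions -/

/-- The base test functions `φ₀`: smooth `SL(2, ℤ)`-invariant functions on `ℍ` whose support,
restricted to the standard fundamental domain, is compact, connected, and contained in the
interior. (So the support, as a subset of `Y_0(1)`, is compact and connected.) -/
structure IsBaseTestFunction (φ₀ : ℍ → ℂ) : Prop where
  invariant : ∀ (γ : SL(2, ℤ)) (z : ℍ), φ₀ (γ • z) = φ₀ z
  smooth : ContMDiff 𝓘(ℝ, ℂ) 𝓘(ℝ, ℂ) ∞ φ₀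
  compact : IsCompact (tsupport φ₀ ∩ 𝒟)
  connected : IsConnected (tsupport φ₀ ∩ 𝒟)
  interior : tsupport φ₀ ∩ 𝒟 ⊆ 𝒟ᵒ

open scoped Classical in
/-- The test function of level `M` attached to the coset `Γ_0(M) γ`: it agrees with `φ₀` on the
translates `g γ 𝒟` with `g ∈ Γ_0(M)` and vanishes elsewhere. -/
def testFunction (φ₀ : ℍ → ℂ) (M : ℕ) (γ : SL(2, ℤ)) (z : ℍ) : ℂ :=
  if ∃ g ∈ Gamma0 M, ∃ w ∈ 𝒟, z = (g * γ) • w then φ₀ z else 0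

/-- The system of all test functions of level `M` obtained from `φ₀`, one for each coset of
`Γ_0(M)` in `SL(2, ℤ)`. -/
def testFunctions (φ₀ : ℍ → ℂ) (M : ℕ) : Set (ℍ → ℂ) := Set.range (testFunction φ₀ M)

/-! ### The coefficients in the main term -/

/-- The coefficient `c_1 = ζ(2) / L(2, χ_{0,M}) (M⁻¹ - M⁻²)` of `⟨G, φ⟩_M`, for `M` prime, where
`χ_{0,M}` is the principal character modulo `M`. -/
def c1 (M : ℕ) [NeZero M] : ℂ :=
  riemannZeta 2 / DirichletCharacter.LFunction (1 : DirichletCharacter ℂ M) 2 *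
    ((M : ℂ)⁻¹ - ((M : ℂ) ^ 2)⁻¹)

/-- The coefficient `c_M` of `⟨G|_M, φ⟩_M`, for `M` prime; it is equal to `c_1`. -/
def cM (M : ℕ) [NeZero M] : ℂ := c1 M

end

end ShrinkingQUE

namespace ShrinkingQUE

open MeasureTheory Filter CongruenceSubgroup

/-! For prime `M` the coefficients equal `1 / (M + 1)`, so it suffices to bound both inner products
by a constant times `‖φ₀‖_1`. A test function lives on a single coset `Γ_0(M) γ`, so each inner
product is one integral over `𝒟`, of `G(q z)` or `G(M q z)` against the conjugate of `φ₀(z)`, with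
`q ∈ Γ_0(M) γ`. `G` is `SL(2, ℤ)`-invariant and bounded on the part of `𝒟` below a given height, so
`⟨G, φ⟩_M` is harmless for every coset. For `G|_M` the whole `SL(2, ℤ)`-orbit of `M q z` must stay
below a fixed height.

Take `γ = S T ^ j` with `0 ≤ j < M`. The heights in that orbit are `M y / |u z + v|²` with `v ≡ u j`
mod `M`; a large one forces `(u, v)` to be a non-zero vector with both entries at most `√(M / 6)`
(`im_smul_dilatePoint_le`). As `M` is prime, such a vector with `u > 0` determines `j`, and there
are at most `M / 2` of them (`two_mul_card_hasShortVector_le`). The remaining `j` give `δ = 1 / 2`.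

The existence and boundedness of `G` come from comparing each row `∑ₙ |m z + n| ^ (-2 s)`, `m ≠ 0`,
with the corresponding integral over the line. The integrals add up to a multiple of `ζ(2 s - 1)`,
which carries the pole at `s = 1`; the differences form a series converging past `Re s = 1`,
uniformly for `z` in vertical strips (`exists_norm_defectTerm_le`, `eisensteinE_eq`). -/

/-! ### The function `‖w‖ ^ (-2 s)` -/

/-- `‖w‖ ^ (-2 s)` for complex `w` and `s`. -/
noncomputable def absPow (s w : ℂ) : ℂ := ((‖w‖ : ℝ) : ℂ) ^ (-(2 * s))

lemma norm_absPow (s : ℂ) {w : ℂ} (hw : w ≠ 0) : ‖absPow s w‖ = ‖w‖ ^ (-(2 * s.re)) := by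
  rw [absPow, Complex.norm_cpow_eq_rpow_re_of_pos (norm_pos_iff.2 hw)]
  simp

lemma absPow_zero {s : ℂ} (hs : s ≠ 0) : absPow s 0 = 0 := by
  simp [absPow, hs]

lemma absPow_mul (s w₁ w₂ : ℂ) : absPow s (w₁ * w₂) = absPow s w₁ * absPow s w₂ := by
  rw [absPow, absPow, absPow, norm_mul, Complex.ofReal_mul,
    Complex.mul_cpow_ofReal_nonneg (norm_nonneg _) (norm_nonneg _)]

lemma absPow_eq_exp (s : ℂ) {w : ℂ} (hw : w ≠ 0) :
    absPow s w = Complex.exp (s * ((-Real.log (Complex.normSq w) : ℝ) : ℂ)) := by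
  have h : ((‖w‖ : ℝ) : ℂ) ≠ 0 := by simpa using hw
  rw [absPow, Complex.cpow_def_of_ne_zero h, Complex.normSq_eq_norm_sq, Real.log_pow,
    ← Complex.ofReal_log (norm_nonneg _)]
  push_cast
  ring_nf

lemma add_ofReal_ne_zero {w : ℂ} (hw : w.im ≠ 0) (t : ℝ) : w + t ≠ 0 := by
  intro h
  apply hw
  simpa using congrArg Complex.im h

lemma hasDerivAt_normSq_add_ofReal (w : ℂ) (t : ℝ) :
    HasDerivAt (fun t : ℝ => Complex.normSq (w + t)) (2 * (w.re + t)) t := by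
  have h : (fun t : ℝ => Complex.normSq (w + t)) =
      fun t : ℝ => (w.re + t) * (w.re + t) + w.im * w.im := by
    ext t
    simp [Complex.normSq_apply]
  rw [h]
  have h1 : HasDerivAt (fun t : ℝ => w.re + t) 1 t := (hasDerivAt_id t).const_add _
  convert! (h1.mul h1).add_const (w.im * w.im) using 1
  ring

lemma hasDerivAt_absPow_add_ofReal (s : ℂ) {w : ℂ} (hw : w.im ≠ 0) (t : ℝ) :
    HasDerivAt (fun t : ℝ => absPow s (w + t))
      (absPow s (w + t) * (s * ((-(2 * (w.re + t) / Complex.normSq (w + t)) : ℝ) : ℂ))) t := by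
  have hne := add_ofReal_ne_zero hw
  have h : (fun t : ℝ => absPow s (w + t)) =
      fun t : ℝ => Complex.exp (s * ((-Real.log (Complex.normSq (w + t)) : ℝ) : ℂ)) :=
    funext fun t => absPow_eq_exp s (hne t)
  rw [absPow_eq_exp s (hne t), h]
  have hlog := ((hasDerivAt_normSq_add_ofReal w t).log (by simpa using hne t)).neg
  exact (hlog.ofReal_comp.const_mul s).cexp

/-- The logarithmic derivative of `|w + t|²` is at most `2 / |w + t|`, so differentiating gains one
power of decay. -/
lemma norm_deriv_absPow_add_ofReal_le (s : ℂ) {w : ℂ} (hw : w.im ≠ 0) (t : ℝ) :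
    ‖absPow s (w + t) * (s * ((-(2 * (w.re + t) / Complex.normSq (w + t)) : ℝ) : ℂ))‖ ≤
      2 * ‖s‖ * ‖w + t‖ ^ (-(2 * s.re + 1)) := by
  have hne := add_ofReal_ne_zero hw t
  have hpos : 0 < ‖w + t‖ := norm_pos_iff.2 hne
  have hre : |w.re + t| ≤ ‖w + t‖ := by simpa using Complex.abs_re_le_norm (w + t)
  have h1 : |2 * (w.re + t) / Complex.normSq (w + t)| ≤ 2 * ‖w + t‖⁻¹ := by
    rw [Complex.normSq_eq_norm_sq, abs_div, abs_mul, abs_two, abs_of_pos (pow_pos hpos 2),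
      div_le_iff₀ (pow_pos hpos 2)]
    calc 2 * |w.re + t| ≤ 2 * ‖w + t‖ := by gcongr
      _ = _ := by field_simp
  rw [norm_mul, norm_mul, norm_absPow s hne, Complex.norm_real, Real.norm_eq_abs, abs_neg]
  calc ‖w + t‖ ^ (-(2 * s.re)) * (‖s‖ * |2 * (w.re + t) / Complex.normSq (w + t)|)
      ≤ ‖w + t‖ ^ (-(2 * s.re)) * (‖s‖ * (2 * ‖w + t‖⁻¹)) := by gcongr
    _ = 2 * ‖s‖ * (‖w + t‖ ^ (-(2 * s.re)) * ‖w + t‖ ^ (-1 : ℝ)) := by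
      rw [Real.rpow_neg_one]; ring
    _ = _ := by rw [← Real.rpow_add hpos]; ring_nf

lemma continuous_absPow_add_ofReal (s : ℂ) {w : ℂ} (hw : w.im ≠ 0) :
    Continuous fun t : ℝ => absPow s (w + t) :=
  continuous_iff_continuousAt.2 fun t => (hasDerivAt_absPow_add_ofReal s hw t).continuousAt

lemma measurable_absPow (s : ℂ) : Measurable (absPow s) := by
  unfold absPow
  fun_prop

/-- The difference between the value at `0` and the average over `[0, 1]` of
`t ↦ ‖w + t‖ ^ (-2 s)`. -/
noncomputable def absPowDefect (s w : ℂ) : ℂ :=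
  absPow s w - ∫ t : ℝ in (0)..1, absPow s (w + t)

/-- The defect is the average of `f 0 - f t` over `[0, 1]`, which the mean value inequality bounds
by the supremum of `|f'|`. -/
lemma norm_absPowDefect_le {s w : ℂ} (hw : w.im ≠ 0) {C : ℝ}
    (hC : ∀ t ∈ Set.Icc (0 : ℝ) 1, 2 * ‖s‖ * ‖w + t‖ ^ (-(2 * s.re + 1)) ≤ C) :
    ‖absPowDefect s w‖ ≤ C := by
  have h0 : absPowDefect s w = ∫ t : ℝ in (0)..1, (absPow s (w + (0 : ℝ)) - absPow s (w + t)) := by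
    rw [intervalIntegral.integral_sub (by simp)
      ((continuous_absPow_add_ofReal s hw).intervalIntegrable _ _)]
    simp [absPowDefect]
  rw [h0]
  have hb : ∀ t ∈ Set.Icc (0 : ℝ) 1, ‖absPow s (w + (0 : ℝ)) - absPow s (w + t)‖ ≤ C := by
    intro t ht
    have h0C : 0 ≤ C := (by positivity : (0 : ℝ) ≤ _).trans (hC 0 (by simp))
    have := (convex_Icc (0 : ℝ) 1).norm_image_sub_le_of_norm_hasDerivWithin_le
      (f := fun t : ℝ => absPow s (w + t))
      (fun x _ => (hasDerivAt_absPow_add_ofReal s hw x).hasDerivWithinAt)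
      (fun x hx => (norm_deriv_absPow_add_ofReal_le s hw x).trans (hC x hx)) ht
      (show (0 : ℝ) ∈ Set.Icc (0 : ℝ) 1 by simp)
    refine this.trans ?_
    rw [zero_sub, norm_neg, Real.norm_eq_abs, abs_of_nonneg ht.1]
    exact mul_le_of_le_one_right h0C ht.2
  have := intervalIntegral.norm_integral_le_of_norm_le_const (a := (0 : ℝ)) (b := 1)
    (f := fun t : ℝ => absPow s (w + (0 : ℝ)) - absPow s (w + t)) (C := C) (fun t ht => hb t (by
      rw [Set.uIoc_of_le zero_le_one] at ht
      exact ⟨ht.1.le, ht.2⟩))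
  simpa using this

lemma differentiable_absPow {w : ℂ} (hw : w ≠ 0) : Differentiable ℂ fun s => absPow s w := by
  simp only [absPow_eq_exp _ hw]
  fun_prop

lemma continuous_log_normSq_add_ofReal {w : ℂ} (hw : w.im ≠ 0) :
    Continuous fun t : ℝ => -Real.log (Complex.normSq (w + t)) :=
  continuous_iff_continuousAt.2 fun t => ((hasDerivAt_normSq_add_ofReal w t).log
    (by simpa using add_ofReal_ne_zero hw t)).neg.continuousAt

/-- Written as a complex moment generating function, the integral is holomorphic in `s` wherever the
real exponentials are integrable. -/
lemma integral_absPow_eq_complexMGF {w : ℂ} (hw : w.im ≠ 0) (μ : Measure ℝ) (s : ℂ) :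
    ∫ t : ℝ, absPow s (w + t) ∂μ =
      ProbabilityTheory.complexMGF (fun t : ℝ => -Real.log (Complex.normSq (w + t))) μ s := by
  rw [ProbabilityTheory.complexMGF]
  exact integral_congr_ae (.of_forall fun t => absPow_eq_exp s (add_ofReal_ne_zero hw t))

lemma differentiable_absPowDefect {w : ℂ} (hw : w.im ≠ 0) :
    Differentiable ℂ fun s => absPowDefect s w := by
  have hw0 : w ≠ 0 := by rintro rfl; simp at hw
  refine (differentiable_absPow hw0).sub fun s => ?_
  have h : (fun s => ∫ t : ℝ in (0)..1, absPow s (w + t)) =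
      ProbabilityTheory.complexMGF (fun t : ℝ => -Real.log (Complex.normSq (w + t)))
        (volume.restrict (Set.Ioc 0 1)) := by
    ext s
    rw [intervalIntegral.integral_of_le zero_le_one, integral_absPow_eq_complexMGF hw]
  rw [h]
  refine (ProbabilityTheory.analyticAt_complexMGF ?_).differentiableAt
  have : ProbabilityTheory.integrableExpSet (fun t : ℝ => -Real.log (Complex.normSq (w + t)))
      (volume.restrict (Set.Ioc 0 1)) = Set.univ := by
    refine Set.eq_univ_of_forall fun a => ?_
    have hc : Continuous fun t : ℝ => Real.exp (a * -Real.log (Complex.normSq (w + t))) :=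
      Real.continuous_exp.comp (continuous_const.mul (continuous_log_normSq_add_ofReal hw))
    exact (hc.integrableOn_Icc (a := 0) (b := 1)).mono_set Set.Ioc_subset_Icc_self
  rw [this, interior_univ]
  trivial

/-! ### The integral of `‖w + t‖ ^ (-2 s)` over the real line -/

/-- `∫ (1 + u ^ 2) ^ (-s) du`. -/
noncomputable def lineIntegral (s : ℂ) : ℂ := ∫ u : ℝ, absPow s (Complex.I + u)

lemma normSq_I_add (u : ℝ) : Complex.normSq (Complex.I + u) = 1 + ‖u‖ ^ 2 := by
  simp [Complex.normSq_apply]; ring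

lemma analyticAt_lineIntegral {s : ℂ} (hs : 1 / 2 < s.re) : AnalyticAt ℂ lineIntegral s := by
  have h : lineIntegral = ProbabilityTheory.complexMGF
      (fun t : ℝ => -Real.log (Complex.normSq (Complex.I + t))) volume := by
    ext s
    exact integral_absPow_eq_complexMGF (by simp) _ s
  rw [h]
  refine ProbabilityTheory.analyticAt_complexMGF ?_
  refine mem_interior.2 ⟨Set.Ioi (1 / 2), fun a ha => ?_, isOpen_Ioi, hs⟩
  have ha : (1 : ℝ) / 2 < a := ha
  have := integrable_rpow_neg_one_add_norm_sq (E := ℝ) (μ := volume) (r := 2 * a)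
    (by simp; linarith)
  refine this.congr (.of_forall fun u => ?_)
  simp only [normSq_I_add]
  rw [Real.rpow_def_of_pos (by positivity)]
  ring_nf

lemma integrable_absPow_I_add {s : ℂ} (hs : 1 / 2 < s.re) :
    Integrable fun u : ℝ => absPow s (Complex.I + u) := by
  have := integrable_rpow_neg_one_add_norm_sq (E := ℝ) (μ := volume) (r := 2 * s.re)
    (by simp; linarith)
  refine this.mono' (continuous_absPow_add_ofReal s (by simp)).aestronglyMeasurable
    (.of_forall fun u => ?_)
  have hne := add_ofReal_ne_zero (w := Complex.I) (by simp) u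
  rw [norm_absPow s hne, ← normSq_I_add, Complex.normSq_eq_norm_sq, ← Real.rpow_natCast,
    ← Real.rpow_mul (norm_nonneg _)]
  refine le_of_eq ?_
  push_cast
  ring_nf

/-- In modulus `w + t` is `|Im w|` times a point of the line `i + ℝ`, so all line integrals are
rescalings of one. -/
lemma absPow_add_eq (s : ℂ) {w : ℂ} (hw : w.im ≠ 0) (t : ℝ) :
    absPow s (w + t) =
      absPow s ((|w.im| : ℝ) : ℂ) * absPow s (Complex.I + ((|w.im|⁻¹ * (t + w.re) : ℝ) : ℂ)) := by
  have hpos : 0 < |w.im| := abs_pos.2 hw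
  rw [← absPow_mul, absPow, absPow]
  congr 2
  rw [← sq_eq_sq₀ (norm_nonneg _) (norm_nonneg _), ← Complex.normSq_eq_norm_sq,
    ← Complex.normSq_eq_norm_sq, Complex.normSq_mul, normSq_I_add, Complex.normSq_ofReal,
    Complex.normSq_apply, Real.norm_eq_abs, sq_abs]
  simp only [Complex.add_re, Complex.ofReal_re, Complex.add_im, Complex.ofReal_im, add_zero]
  field_simp
  rw [sq_abs]
  ring

lemma integrable_absPow_add {s w : ℂ} (hs : 1 / 2 < s.re) (hw : w.im ≠ 0) :
    Integrable fun t : ℝ => absPow s (w + t) := by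
  simp only [absPow_add_eq s hw]
  refine Integrable.const_mul ?_ _
  exact ((integrable_absPow_I_add hs).comp_mul_left' (R := |w.im|⁻¹)
    (by simpa using hw)).comp_add_right w.re

lemma integral_absPow_add {s w : ℂ} (hw : w.im ≠ 0) :
    ∫ t : ℝ, absPow s (w + t) = ((|w.im| : ℝ) : ℂ) ^ (-(2 * s - 1)) * lineIntegral s := by
  have hpos : 0 < |w.im| := abs_pos.2 hw
  simp only [absPow_add_eq s hw]
  rw [integral_const_mul,
    integral_add_right_eq_self (fun t : ℝ => absPow s (Complex.I + ((|w.im|⁻¹ * t : ℝ) : ℂ))) w.re,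
    Measure.integral_comp_mul_left (fun t : ℝ => absPow s (Complex.I + (t : ℂ))), inv_inv,
    abs_of_pos hpos, Complex.real_smul, ← mul_assoc, lineIntegral]
  congr 1
  have h0 : ((|w.im| : ℝ) : ℂ) ≠ 0 := by exact_mod_cast hpos.ne'
  rw [absPow, Complex.norm_real, Real.norm_eq_abs, abs_abs, neg_sub, sub_eq_neg_add,
    Complex.cpow_add _ _ h0, Complex.cpow_one]

/-- The unit intervals `[n, n + 1]` tile the line, so the averages sum to the full integral. -/
lemma hasSum_absPowDefect {s w : ℂ} (hs : 1 / 2 < s.re) (hw : w.im ≠ 0)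
    (hsum : Summable fun n : ℤ => absPow s (w + n)) :
    HasSum (fun n : ℤ => absPowDefect s (w + n))
      ((∑' n : ℤ, absPow s (w + n)) -
        ((|w.im| : ℝ) : ℂ) ^ (-(2 * s - 1)) * lineIntegral s) := by
  rw [← integral_absPow_add hw]
  refine hsum.hasSum.sub ?_
  refine (integrable_absPow_add hs hw).hasSum_intervalIntegral_comp_add_int.congr_fun fun n => ?_
  simp only [add_assoc, Complex.ofReal_add, Complex.ofReal_intCast, add_comm (n : ℂ)]

/-! ### Lattice sums -/

lemma hasSum_absPow_int {s : ℂ} (hs : 1 / 2 < s.re) :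
    HasSum (fun n : ℤ => absPow s n) (2 * riemannZeta (2 * s)) := by
  have hs1 : 1 < (2 * s).re := by simp; linarith
  have hs0 : s ≠ 0 := by rintro rfl; norm_num at hs
  have h : HasSum (fun n : ℕ => absPow s n) (riemannZeta (2 * s)) := by
    rw [zeta_eq_tsum_one_div_nat_cpow hs1]
    convert! (Complex.summable_one_div_nat_cpow.2 hs1).hasSum using 2 with n
    rw [absPow, Complex.norm_natCast, Complex.cpow_neg, one_div, Complex.ofReal_natCast]
  have h' := HasSum.of_nat_of_neg (f := fun n : ℤ => absPow s n) (by simpa using h)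
    (by simpa [absPow] using h)
  simpa [absPow_zero hs0, two_mul] using h'

lemma im_int_mul_add (z : ℍ) (v : Fin 2 → ℤ) :
    ((v 0 : ℂ) * z + v 1).im = v 0 * z.im := by
  simp

lemma int_mul_add_ne_zero (z : ℍ) {v : Fin 2 → ℤ} (hv : v ≠ 0) : (v 0 : ℂ) * z + v 1 ≠ 0 := by
  have h := EisensteinSeries.r_mul_max_le z hv
  exact norm_pos_iff.1 ((mul_pos (EisensteinSeries.r_pos z) (norm_pos_iff.2 hv)).trans_le h)

lemma im_int_mul_add_ne_zero (z : ℍ) {v : Fin 2 → ℤ} (hv : v 0 ≠ 0) :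
    ((v 0 : ℂ) * z + v 1).im ≠ 0 := by
  rw [im_int_mul_add]
  exact mul_ne_zero (by exact_mod_cast hv) z.im_ne_zero

lemma one_le_norm_of_ne_zero {v : Fin 2 → ℤ} (hv : v ≠ 0) : 1 ≤ ‖v‖ := by
  obtain ⟨i, hi⟩ := Function.ne_iff.1 hv
  refine le_trans ?_ (norm_le_pi_norm v i)
  rw [Int.norm_eq_abs]
  exact_mod_cast Int.one_le_abs hi

lemma summable_absPow (z : ℍ) {s : ℂ} (hs : 1 < s.re) :
    Summable fun v : Fin 2 → ℤ => ‖absPow s ((v 0 : ℂ) * z + v 1)‖ := by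
  have hs0 : s ≠ 0 := by rintro rfl; norm_num at hs
  refine Summable.of_nonneg_of_le (fun _ => norm_nonneg _) (fun v => ?_)
    ((EisensteinSeries.summable_one_div_norm_rpow (k := 2 * s.re) (by linarith)).mul_left
      (EisensteinSeries.r z ^ (-(2 * s.re))))
  rcases eq_or_ne v 0 with rfl | hv
  · simp only [Pi.zero_apply, Int.cast_zero, zero_mul, add_zero, absPow_zero hs0, norm_zero]
    have := EisensteinSeries.r_pos z
    positivity
  · rw [norm_absPow s (int_mul_add_ne_zero z hv)]
    exact EisensteinSeries.summand_bound z (by linarith) v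

/-- On a vertical strip, the distance from a non-real lattice point to the lattice translates
of `[-1, 0]` is bounded below by a multiple of the norm of the coefficients. -/
lemma exists_mul_norm_le (A : ℝ) {B : ℝ} (hB : 0 < B) :
    ∃ ρ : ℝ, 0 < ρ ∧ ρ ≤ 1 ∧ ∀ z ∈ UpperHalfPlane.verticalStrip A B, ∀ v : Fin 2 → ℤ, v 0 ≠ 0 →
      ∀ t ∈ Set.Icc (0 : ℝ) 1, ρ * ‖v‖ ≤ ‖(v 0 : ℂ) * z + v 1 + t‖ := by
  set r := min (EisensteinSeries.r ⟨⟨A, B⟩, hB⟩) 1 with hr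
  have hr0 : 0 < r := lt_min (EisensteinSeries.r_pos _) one_pos
  have hr1 : r ≤ 1 := min_le_right _ _
  -- With `D` the distance on the right, `r ≤ D` and `r ‖v‖ ≤ D + 1`; since `r ≤ 1`, `r² ‖v‖ ≤ r D +
  -- r ≤ 2 D`.
  refine ⟨r ^ 2 / 2, by positivity, by nlinarith, fun z hz v hv t ht => ?_⟩
  have hrz : r ≤ EisensteinSeries.r z :=
    (min_le_left _ _).trans (EisensteinSeries.r_lower_bound_on_verticalStrip z hB hz)
  have h1 : r * ‖v‖ ≤ ‖(v 0 : ℂ) * z + v 1‖ :=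
    (mul_le_mul_of_nonneg_right hrz (norm_nonneg _)).trans
      (EisensteinSeries.r_mul_max_le z (by rintro rfl; simp at hv))
  have h2 : r ≤ ‖(v 0 : ℂ) * z + v 1 + t‖ := by
    have hv1 : (1 : ℝ) ≤ (v 0 : ℝ) ^ 2 := by
      have : 1 ≤ (v 0) ^ 2 := by have := sq_pos_of_ne_zero hv; omega
      exact_mod_cast this
    have := EisensteinSeries.auxbound1 z (c := v 0) (v 1 + t) hv1
    refine hrz.trans (this.trans (le_of_eq ?_))
    push_cast
    ring_nf
  have h3 : ‖(v 0 : ℂ) * z + v 1‖ ≤ ‖(v 0 : ℂ) * z + v 1 + t‖ + 1 := by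
    have h := norm_sub_le ((v 0 : ℂ) * z + v 1 + t) t
    rw [add_sub_cancel_right, Complex.norm_real, Real.norm_eq_abs, abs_of_nonneg ht.1] at h
    linarith [ht.2]
  nlinarith [norm_nonneg v]

/-- The terms of the series expressing the difference between the lattice sum and the
corresponding sum of line integrals. -/
noncomputable def defectTerm (z : ℍ) (s : ℂ) (v : Fin 2 → ℤ) : ℂ :=
  if v 0 = 0 then 0 else absPowDefect s ((v 0 : ℂ) * z + v 1)

/-- The difference between the lattice sum over `v 0 ≠ 0` and the sum of line integrals. -/
noncomputable def defectSum (z : ℍ) (s : ℂ) : ℂ := ∑' v, defectTerm z s v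

/-- For `Re s ≥ 3 / 4` the decay exponent `2 Re s + 1` is at least `5 / 2`, which exceeds `2` and so
is summable over `ℤ²`. -/
lemma exists_norm_defectTerm_le (A : ℝ) {B : ℝ} (hB : 0 < B) (S : ℝ) :
    ∃ C : ℝ, 0 < C ∧ ∀ z ∈ UpperHalfPlane.verticalStrip A B, ∀ s : ℂ, 3 / 4 ≤ s.re → s.re ≤ S →
      ∀ v, ‖defectTerm z s v‖ ≤ ‖s‖ * (C * ‖v‖ ^ (-(5 / 2) : ℝ)) := by
  obtain ⟨ρ, hρ0, hρ1, hρ⟩ := exists_mul_norm_le A hB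
  refine ⟨2 * ρ ^ (-(2 * S + 1)), by positivity, fun z hz s hs hS v => ?_⟩
  rw [defectTerm]
  split_ifs with hv
  · simp only [norm_zero]; positivity
  · have hv1 := one_le_norm_of_ne_zero (v := v) (by rintro rfl; simp at hv)
    refine norm_absPowDefect_le (im_int_mul_add_ne_zero z hv) fun t ht => ?_
    have hle : ‖(v 0 : ℂ) * z + v 1 + t‖ ^ (-(2 * s.re + 1)) ≤
        ρ ^ (-(2 * S + 1)) * ‖v‖ ^ (-(5 / 2) : ℝ) := by
      calc ‖(v 0 : ℂ) * z + v 1 + t‖ ^ (-(2 * s.re + 1))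
          ≤ (ρ * ‖v‖) ^ (-(2 * s.re + 1)) :=
            Real.rpow_le_rpow_of_nonpos (by positivity) (hρ z hz v hv t ht) (by linarith)
        _ = ρ ^ (-(2 * s.re + 1)) * ‖v‖ ^ (-(2 * s.re + 1)) :=
            Real.mul_rpow hρ0.le (norm_nonneg _)
        _ ≤ _ := by
            refine mul_le_mul ?_ ?_ (by positivity) (by positivity)
            · exact Real.rpow_le_rpow_of_exponent_ge hρ0 hρ1 (by linarith)
            · exact Real.rpow_le_rpow_of_exponent_le hv1 (by linarith)
    calc _ ≤ 2 * ‖s‖ * (ρ ^ (-(2 * S + 1)) * ‖v‖ ^ (-(5 / 2) : ℝ)) := by gcongr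
      _ = _ := by ring

lemma mem_verticalStrip_self (z : ℍ) : z ∈ UpperHalfPlane.verticalStrip |z.re| z.im :=
  ⟨le_rfl, le_rfl⟩

lemma summable_defectTerm (z : ℍ) {s : ℂ} (hs : 3 / 4 ≤ s.re) : Summable (defectTerm z s) := by
  obtain ⟨C, -, hC⟩ := exists_norm_defectTerm_le |z.re| z.im_pos s.re
  exact .of_norm_bounded
    (((EisensteinSeries.summable_one_div_norm_rpow (by norm_num)).mul_left C).mul_left ‖s‖)
    (hC z (mem_verticalStrip_self z) s hs le_rfl)

lemma exists_norm_defectSum_one_le (A : ℝ) {B : ℝ} (hB : 0 < B) :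
    ∃ C : ℝ, ∀ z ∈ UpperHalfPlane.verticalStrip A B, ‖defectSum z 1‖ ≤ C := by
  obtain ⟨C, -, hC⟩ := exists_norm_defectTerm_le A hB 1
  exact ⟨_, fun z hz => tsum_of_norm_bounded
    (((EisensteinSeries.summable_one_div_norm_rpow (k := 5 / 2)
      (by norm_num)).mul_left C).mul_left ‖(1 : ℂ)‖).hasSum
    (hC z hz 1 (by norm_num) (by norm_num))⟩

lemma analyticAt_defectSum (z : ℍ) : AnalyticAt ℂ (defectSum z) 1 := by
  obtain ⟨C, hC0, hC⟩ := exists_norm_defectTerm_le |z.re| z.im_pos 2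
  have hd : DifferentiableOn ℂ (defectSum z) (Metric.ball 1 (1 / 4)) := by
    refine Complex.differentiableOn_tsum_of_summable_norm
      (((EisensteinSeries.summable_one_div_norm_rpow (k := 5 / 2)
        (by norm_num)).mul_left C).mul_left 2) (fun v => ?_) Metric.isOpen_ball
      fun v s hs => ?_
    · by_cases hv : v 0 = 0
      · simp only [defectTerm, hv, if_true]
        exact differentiableOn_const _
      · simp only [defectTerm, hv, if_false]
        exact (differentiable_absPowDefect (im_int_mul_add_ne_zero z hv)).differentiableOn
    · have hs' : ‖s - 1‖ < 1 / 4 := by simpa [dist_eq_norm] using hs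
      have h1 := abs_le.1 ((Complex.abs_re_le_norm (s - 1)).trans hs'.le)
      rw [Complex.sub_re, Complex.one_re] at h1
      have h2 : ‖s‖ ≤ 2 := by
        have := norm_add_le (s - 1) 1
        rw [sub_add_cancel, norm_one] at this
        linarith
      refine (hC z (mem_verticalStrip_self z) s (by linarith [h1.1]) (by linarith [h1.2]) v).trans
        (mul_le_mul_of_nonneg_right h2 (by positivity))
  exact hd.analyticAt (Metric.ball_mem_nhds _ (by norm_num))

lemma measurable_defectSum (s : ℂ) : Measurable fun z => defectSum z s := by
  refine Measurable.tsum fun v => ?_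
  by_cases hv : v 0 = 0
  · simp only [defectTerm, hv, if_true]
    exact measurable_const
  · simp only [defectTerm, hv, if_false, absPowDefect]
    have hm : Measurable fun z : ℍ => (v 0 : ℂ) * (z : ℂ) + v 1 := by fun_prop
    refine ((measurable_absPow s).comp hm).sub ?_
    simp only [intervalIntegral.integral_of_le zero_le_one]
    refine (StronglyMeasurable.integral_prod_right (Measurable.stronglyMeasurable ?_)).measurable
    exact (measurable_absPow s).comp ((hm.comp measurable_fst).add
      (Complex.measurable_ofReal.comp measurable_snd))

/-- The rows of the lattice sum. -/
lemma tsum_row (z : ℍ) {s : ℂ} (hs : 1 < s.re) (m : ℤ) :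
    ∑' n : ℤ, absPow s ((m : ℂ) * z + n) =
      (if m = 0 then 2 * riemannZeta (2 * s) else 0) + (∑' n : ℤ, defectTerm z s ![m, n]) +
        absPow (s - 1 / 2) m * ((z.im : ℂ) ^ (-(2 * s - 1)) * lineIntegral s) := by
  have hs' : s - 1 / 2 ≠ 0 := by
    intro h
    have := congrArg Complex.re h
    simp at this
    linarith
  -- The single formula also covers `m = 0`: there `absPow (s - 1 / 2) 0 = 0`, and only the zeta
  -- value survives.
  rcases eq_or_ne m 0 with rfl | hm
  · simp only [Int.cast_zero, zero_mul, zero_add, (hasSum_absPow_int (by linarith : 1 / 2 < s.re)).tsum_eq,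
      if_true, absPow_zero hs', add_zero]
    simp [defectTerm]
  · have him : ((m : ℂ) * z).im ≠ 0 := by
      simpa using ⟨hm, z.im_ne_zero⟩
    have hsum : Summable fun n : ℤ => absPow s ((m : ℂ) * z + n) := by
      refine ((summable_absPow z hs).of_norm.comp_injective (i := fun n : ℤ => ![m, n])
        fun a b h => by simpa using congrFun h 1).congr fun n => by simp
    have h := (hasSum_absPowDefect (by linarith) him hsum).tsum_eq
    have hd : ∀ n : ℤ, defectTerm z s ![m, n] = absPowDefect s ((m : ℂ) * z + n) := by
      intro n
      simp [defectTerm, hm]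
    simp only [hd, h, if_neg hm]
    have : ((|((m : ℂ) * z).im| : ℝ) : ℂ) ^ (-(2 * s - 1)) =
        absPow (s - 1 / 2) m * (z.im : ℂ) ^ (-(2 * s - 1)) := by
      have h1 : |((m : ℂ) * z).im| = ‖(m : ℂ)‖ * z.im := by
        simp [abs_mul, abs_of_pos z.im_pos]
      rw [h1, Complex.ofReal_mul, Complex.mul_cpow_ofReal_nonneg (norm_nonneg _) z.im_pos.le,
        absPow]
      ring_nf
    rw [this]
    ring

/-- Summing the rows, `∑ |m| ^ (1 - 2 s)` becomes `2 ζ(2 s - 1)`, the only factor singular at `s =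
1`. -/
lemma tsum_absPow (z : ℍ) {s : ℂ} (hs : 1 < s.re) :
    ∑' v : Fin 2 → ℤ, absPow s ((v 0 : ℂ) * z + v 1) =
      2 * riemannZeta (2 * s) + defectSum z s +
        2 * riemannZeta (2 * s - 1) * ((z.im : ℂ) ^ (-(2 * s - 1)) * lineIntegral s) := by
  have hA := (finTwoArrowEquiv ℤ).symm.summable_iff.2 (summable_absPow z hs).of_norm
  have hD := (finTwoArrowEquiv ℤ).symm.summable_iff.2
    (summable_defectTerm z (by linarith : 3 / 4 ≤ s.re))
  have h1 : HasSum (fun m : ℤ => if m = 0 then 2 * riemannZeta (2 * s) else 0)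
      (2 * riemannZeta (2 * s)) := by
    simpa using hasSum_ite_eq (0 : ℤ) (2 * riemannZeta (2 * s))
  have h2 : HasSum (fun m : ℤ => ∑' n : ℤ, defectTerm z s ![m, n]) (defectSum z s) := by
    have := hD.prod.hasSum
    rw [← hD.tsum_prod] at this
    rw [defectSum, ← (finTwoArrowEquiv ℤ).symm.tsum_eq]
    exact this
  have h3 : HasSum (fun m : ℤ => absPow (s - 1 / 2) m) (2 * riemannZeta (2 * s - 1)) := by
    have := hasSum_absPow_int (s := s - 1 / 2) (by simp; linarith)
    rwa [show 2 * (s - 1 / 2) = 2 * s - 1 by ring] at this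
  have h := ((h1.add h2).add (h3.mul_right ((z.im : ℂ) ^ (-(2 * s - 1)) * lineIntegral s))).tsum_eq
  rw [← h, ← (finTwoArrowEquiv ℤ).symm.tsum_eq]
  refine hA.tsum_prod.trans (tsum_congr fun m => ?_)
  rw [← tsum_row z hs m]
  simp

lemma tsum_coprime_eq_tsum_gammaSet (z : ℍ) (s : ℂ) :
    ∑' p : {p : ℤ × ℤ // IsCoprime p.1 p.2}, absPow s ((p.1.1 : ℂ) * z + p.1.2) =
      ∑' v : EisensteinSeries.gammaSet 1 1 0, absPow s ((v.1 0 : ℂ) * z + v.1 1) := by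
  let e : {p : ℤ × ℤ // IsCoprime p.1 p.2} ≃ EisensteinSeries.gammaSet 1 1 0 :=
    (finTwoArrowEquiv ℤ).symm.subtypeEquiv fun p => by
      rw [EisensteinSeries.mem_gammaSet_one]; simp
  rw [← e.tsum_eq]
  rfl

/-- Sorting lattice points by the greatest common divisor of their coefficients. -/
lemma tsum_absPow_eq_zeta_mul (z : ℍ) {s : ℂ} (hs : 1 < s.re) :
    ∑' v : Fin 2 → ℤ, absPow s ((v 0 : ℂ) * z + v 1) = riemannZeta (2 * s) *
      ∑' p : {p : ℤ × ℤ // IsCoprime p.1 p.2}, absPow s ((p.1.1 : ℂ) * z + p.1.2) := by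
  have hs0 : s ≠ 0 := by rintro rfl; norm_num at hs
  have hs2 : 1 < (2 * s).re := by simp; linarith
  have hA := (summable_absPow z hs).of_norm
  rw [tsum_coprime_eq_tsum_gammaSet, ← EisensteinSeries.gammaSetDivGcdSigmaEquiv.symm.tsum_eq]
  have hA' := EisensteinSeries.gammaSetDivGcdSigmaEquiv.symm.summable_iff.2 hA
  refine hA'.tsum_sigma.trans ?_
  rw [zeta_eq_tsum_one_div_nat_cpow hs2, ← tsum_mul_right]
  refine tsum_congr fun r => ?_
  simp only [EisensteinSeries.gammaSetDivGcdSigmaEquiv_symm_eq, Function.comp_apply]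
  have hmul : ∀ v : EisensteinSeries.gammaSet 1 r 0, absPow s ((v.1 0 : ℂ) * z + v.1 1) =
      1 / (r : ℂ) ^ (2 * s) *
        absPow s ((EisensteinSeries.divIntMap r v.1 0 : ℂ) * z +
          EisensteinSeries.divIntMap r v.1 1) := by
    intro v
    conv_lhs => rw [EisensteinSeries.gammaSet_eq_gcd_mul_divIntMap v.2]
    have : absPow s r = 1 / (r : ℂ) ^ (2 * s) := by
      rw [absPow, Complex.norm_natCast, Complex.cpow_neg, one_div, Complex.ofReal_natCast]
    rw [← this, ← absPow_mul]
    congr 1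
    simp
    ring
  -- The gcd `0` term vanishes on both sides, with `1 / 0 ^ (2 s) = 0` as the zeroth term of the
  -- zeta series.
  rcases eq_or_ne r 0 with rfl | hr
  · simp [hmul, hs0]
  · have : NeZero r := ⟨hr⟩
    simp only [hmul, tsum_mul_left]
    rw [← (EisensteinSeries.gammaSetDivGcdEquiv r).tsum_eq]
    rfl

/-! ### The Laurent expansion of the Eisenstein series -/

lemma eisensteinE_eq_tsum_absPow (z : ℍ) (s : ℂ) :
    eisensteinE z s = (z.im : ℂ) ^ s / 2 *
      ∑' p : {p : ℤ × ℤ // IsCoprime p.1 p.2}, absPow s ((p.1.1 : ℂ) * z + p.1.2) := by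
  rw [eisensteinE, ← tsum_mul_left, ← tsum_mul_left]
  refine tsum_congr fun p => ?_
  rw [absPow, Complex.cpow_neg]
  ring

/-- The coefficient `B(s) / (2 ζ(2 s))` in the second constant term of the Eisenstein series. -/
noncomputable def scatteringCoeff (s : ℂ) : ℂ := lineIntegral s / (2 * riemannZeta (2 * s))

lemma zeta_two_ne_zero : riemannZeta 2 ≠ 0 :=
  riemannZeta_ne_zero_of_one_lt_re (by norm_num)

lemma analyticAt_zeta_two_mul : AnalyticAt ℂ (fun s : ℂ => riemannZeta (2 * s)) 1 := by
  refine AnalyticAt.fun_comp (g := riemannZeta) (f := fun s : ℂ => 2 * s) ?_ (by fun_prop)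
  exact analyticOn_riemannZeta _ (by norm_num)

lemma analyticAt_scatteringCoeff : AnalyticAt ℂ scatteringCoeff 1 := by
  refine (analyticAt_lineIntegral (by norm_num)).div
    (analyticAt_const.mul analyticAt_zeta_two_mul) ?_
  simpa using zeta_two_ne_zero

lemma eisensteinE_eq (z : ℍ) {s : ℂ} (hs : 1 < s.re) :
    eisensteinE z s = (z.im : ℂ) ^ (1 - s) * scatteringCoeff s * (s - 1)⁻¹ +
      ((z.im : ℂ) ^ s + (z.im : ℂ) ^ s * defectSum z s / (2 * riemannZeta (2 * s)) +
        2 * ((z.im : ℂ) ^ (1 - s) * scatteringCoeff s) * riemannZeta₀ (2 * s - 1)) := by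
  have hs2 : 1 < (2 * s).re := by simp; linarith
  have hz := riemannZeta_ne_zero_of_one_lt_re hs2
  have hy : (z.im : ℂ) ≠ 0 := by exact_mod_cast z.im_ne_zero
  have hs1 : s - 1 ≠ 0 := by
    intro h
    have := congrArg Complex.re h
    simp at this
    linarith
  have h := (tsum_absPow_eq_zeta_mul z hs).symm.trans (tsum_absPow z hs)
  rw [mul_comm, ← eq_div_iff hz] at h
  have hpow : (z.im : ℂ) ^ (-(2 * s - 1)) = (z.im : ℂ) ^ (1 - s) / (z.im : ℂ) ^ s := by
    rw [← Complex.cpow_sub _ _ hy]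
    ring_nf
  have hys : (z.im : ℂ) ^ s ≠ 0 := by simp [Complex.cpow_eq_zero_iff, hy]
  rw [eisensteinE_eq_tsum_absPow, h, hpow, riemannZeta_eq_inv_sub_add (s := 2 * s - 1),
    scatteringCoeff, show 2 * s - 1 - 1 = 2 * (s - 1) by ring, mul_inv]
  · field_simp
    ring
  · intro h
    apply hs1
    linear_combination h / 2

/-- `W s / (s - a) = W a / (s - a) + W' a + o(1)`. -/
lemma isLaurentConstantTerm_of_simple_pole {F W H : ℂ → ℂ} {a : ℂ} (hW : AnalyticAt ℂ W a)
    (hH : AnalyticAt ℂ H a) (hF : ∀ s, F s = W s * (s - a)⁻¹ + H s) :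
    IsLaurentConstantTerm F a (deriv W a + H a) := by
  obtain rfl : F = fun s => W s * (s - a)⁻¹ + H s := funext hF
  refine ⟨by fun_prop, Polynomial.C (deriv W a + H a) + Polynomial.C (W a) * Polynomial.X,
    by simp, ?_⟩
  have h1 := hasDerivAt_iff_tendsto_slope.1 hW.differentiableAt.hasDerivAt
  have h2 := hH.continuousAt.tendsto.mono_left (nhdsWithin_le_nhds (s := {a}ᶜ))
  have h := (h1.add h2).sub_const (deriv W a + H a)
  rw [sub_self] at h
  refine h.congr fun s => ?_
  simp only [slope_def_field, Polynomial.eval_add, Polynomial.eval_C, Polynomial.eval_mul,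
    Polynomial.eval_X]
  ring

/-- The right-hand side of `eisensteinE_eq` is itself the continuation; the logarithm comes from
differentiating `y ^ (1 - s)`. -/
lemma isEisensteinConstantTerm_explicit (z : ℍ) :
    IsEisensteinConstantTerm z (deriv scatteringCoeff 1 - Real.log z.im * scatteringCoeff 1 +
      (z.im + z.im * defectSum z 1 / (2 * riemannZeta 2) +
        2 * scatteringCoeff 1 * riemannZeta₀ 1)) := by
  have hy : (z.im : ℂ) ≠ 0 := by exact_mod_cast z.im_ne_zero
  have hpow : ∀ s, HasDerivAt (fun s : ℂ => (z.im : ℂ) ^ (1 - s))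
      (-((z.im : ℂ) ^ (1 - s) * Complex.log z.im)) s := fun s => by
    simpa using ((hasDerivAt_id s).const_sub 1).const_cpow (c := (z.im : ℂ)) (Or.inl hy)
  have hpowA : AnalyticAt ℂ (fun s : ℂ => (z.im : ℂ) ^ (1 - s)) 1 :=
    (show Differentiable ℂ _ from fun s => (hpow s).differentiableAt).analyticAt 1
  have hpowA' : AnalyticAt ℂ (fun s : ℂ => (z.im : ℂ) ^ s) 1 :=
    (show Differentiable ℂ _ from fun s =>
      ((hasDerivAt_id s).const_cpow (c := (z.im : ℂ)) (Or.inl hy)).differentiableAt).analyticAt 1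
  have hW := hpowA.fun_mul analyticAt_scatteringCoeff
  have hzeta : AnalyticAt ℂ (fun s : ℂ => riemannZeta₀ (2 * s - 1)) 1 :=
    (show Differentiable ℂ _ by fun_prop).analyticAt 1
  have hden := analyticAt_const (v := (2 : ℂ)).fun_mul analyticAt_zeta_two_mul
  have hH := (hpowA'.fun_add ((hpowA'.fun_mul (analyticAt_defectSum z)).fun_div hden
    (by simpa using zeta_two_ne_zero))).fun_add
      ((analyticAt_const (v := (2 : ℂ)).fun_mul hW).fun_mul hzeta)
  refine ⟨fun s => _, fun s hs => (eisensteinE_eq z hs).symm, ?_⟩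
  have h := isLaurentConstantTerm_of_simple_pole hW hH (fun s => rfl)
  have hder : deriv (fun s => (z.im : ℂ) ^ (1 - s) * scatteringCoeff s) 1 =
      deriv scatteringCoeff 1 - Real.log z.im * scatteringCoeff 1 := by
    rw [((hpow 1).fun_mul analyticAt_scatteringCoeff.differentiableAt.hasDerivAt).deriv,
      ← Complex.ofReal_log z.im_pos.le]
    simp
    ring
  rw [hder] at h
  convert! h using 3
  · simp
  · norm_num

lemma isEisensteinConstantTerm_eisensteinG (z : ℍ) :
    IsEisensteinConstantTerm z (eisensteinG z) :=
  Classical.epsilon_spec ⟨_, isEisensteinConstantTerm_explicit z⟩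

lemma eisensteinG_eq (z : ℍ) :
    eisensteinG z = deriv scatteringCoeff 1 - Real.log z.im * scatteringCoeff 1 +
      (z.im + z.im * defectSum z 1 / (2 * riemannZeta 2) +
        2 * scatteringCoeff 1 * riemannZeta₀ 1) :=
  (isEisensteinConstantTerm_eisensteinG z).unique (isEisensteinConstantTerm_explicit z)

lemma measurable_eisensteinG : Measurable eisensteinG := by
  have h : eisensteinG = fun z => deriv scatteringCoeff 1 - Real.log z.im * scatteringCoeff 1 +
      (z.im + z.im * defectSum z 1 / (2 * riemannZeta 2) +
        2 * scatteringCoeff 1 * riemannZeta₀ 1) := funext eisensteinG_eq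
  have him : Measurable UpperHalfPlane.im := UpperHalfPlane.continuous_im.measurable
  have hd := measurable_defectSum 1
  rw [h]
  fun_prop

lemma fd_subset_verticalStrip : 𝒟 ⊆ UpperHalfPlane.verticalStrip (1 / 2) (1 / 2) := by
  intro z hz
  refine ⟨hz.2, ?_⟩
  have := ModularGroup.three_le_four_mul_im_sq_of_mem_fd hz
  nlinarith [z.im_pos]

lemma exists_norm_eisensteinG_le (T : ℝ) :
    ∃ K : ℝ, 0 < K ∧ ∀ z ∈ 𝒟, z.im ≤ T → ‖eisensteinG z‖ ≤ K := by
  obtain ⟨C, hC⟩ := exists_norm_defectSum_one_le (1 / 2) (B := 1 / 2) (by norm_num)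
  set K := ‖deriv scatteringCoeff 1‖ + (|T| + 2) * ‖scatteringCoeff 1‖ +
    (|T| + |T| * |C| / ‖2 * riemannZeta 2‖ + ‖2 * scatteringCoeff 1 * riemannZeta₀ 1‖) with hK
  refine ⟨K + 1, by positivity, fun z hz hT => ?_⟩
  have hs := fd_subset_verticalStrip hz
  have hy : 1 / 2 ≤ z.im := hs.2
  have hyT : z.im ≤ |T| := hT.trans (le_abs_self T)
  have hlog : |Real.log z.im| ≤ |T| + 2 := by
    rw [abs_le]
    constructor
    · have := Real.one_sub_inv_le_log_of_pos z.im_pos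
      have h2 : z.im⁻¹ ≤ 2 := by
        rw [inv_le_comm₀ z.im_pos two_pos]
        linarith
      linarith [abs_nonneg T]
    · have := Real.log_le_sub_one_of_pos z.im_pos
      linarith
  have hD : ‖defectSum z 1‖ ≤ |C| := (hC z hs).trans (le_abs_self C)
  have hny : ‖((z.im : ℝ) : ℂ)‖ ≤ |T| := by
    rwa [Complex.norm_real, Real.norm_eq_abs, abs_of_pos z.im_pos]
  rw [eisensteinG_eq]
  refine le_trans ?_ (le_add_of_nonneg_right zero_le_one)
  refine (norm_add_le _ _).trans (add_le_add ((norm_sub_le _ _).trans (add_le_add le_rfl ?_))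
    ((norm_add_le _ _).trans (add_le_add ((norm_add_le _ _).trans (add_le_add hny ?_)) le_rfl)))
  · rw [norm_mul, Complex.norm_real, Real.norm_eq_abs]
    gcongr
  · rw [norm_div, norm_mul]
    gcongr

/-! ### Invariance -/

lemma denom_mul_smul (γ : SL(2, ℤ)) (z : ℍ) (v : Fin 2 → ℤ) :
    (v 0 : ℂ) * ((γ • z : ℍ) : ℂ) + v 1 =
      ((Matrix.vecMul v γ.1 0 : ℤ) * (z : ℂ) + (Matrix.vecMul v γ.1 1 : ℤ)) /
        UpperHalfPlane.denom γ z := by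
  have hd := UpperHalfPlane.denom_ne_zero γ z
  rw [eq_div_iff hd]
  simp only [UpperHalfPlane.denom, UpperHalfPlane.specialLinearGroup_apply, Matrix.vecMul,
    Matrix.vec2_dotProduct] at hd ⊢
  simp at hd ⊢
  have hd' : (z : ℂ) * γ 1 0 + γ 1 1 ≠ 0 := by rwa [mul_comm]
  field_simp
  ring

/-- Right multiplication by `γ` permutes the coprime pairs, and the resulting power of the
automorphy factor cancels the one from `(Im γ z) ^ s`. -/
lemma eisensteinE_smul (γ : SL(2, ℤ)) (z : ℍ) (s : ℂ) :
    eisensteinE (γ • z) s = eisensteinE z s := by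
  have hd := UpperHalfPlane.denom_ne_zero γ z
  have hfac : ((γ • z).im : ℂ) ^ s = (z.im : ℂ) ^ s * absPow s (UpperHalfPlane.denom γ z) := by
    have hn := norm_pos_iff.2 hd
    rw [ModularGroup.im_smul_eq_div_normSq, div_eq_mul_inv, Complex.ofReal_mul,
      Complex.mul_cpow_ofReal_nonneg z.im_pos.le (inv_nonneg.2 (Complex.normSq_nonneg _))]
    congr 1
    rw [absPow_eq_exp _ hd, Complex.cpow_def_of_ne_zero (by simp [hd]),
      ← Complex.ofReal_log (inv_nonneg.2 (Complex.normSq_nonneg _)), Real.log_inv, mul_comm]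
  rw [eisensteinE_eq_tsum_absPow, eisensteinE_eq_tsum_absPow, hfac, tsum_coprime_eq_tsum_gammaSet,
    tsum_coprime_eq_tsum_gammaSet,
    mul_div_right_comm, mul_assoc, ← tsum_mul_left]
  congr 1
  let σ : EisensteinSeries.gammaSet 1 1 0 ≃ EisensteinSeries.gammaSet 1 1 0 :=
    (EisensteinSeries.gammaSetEquiv 0 γ).trans (Equiv.setCongr (by simp))
  refine (tsum_congr fun v => ?_).trans
    (σ.tsum_eq fun v => absPow s ((v.1 0 : ℂ) * z + v.1 1))
  rw [← absPow_mul, denom_mul_smul, mul_div_cancel₀ _ hd]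
  rfl

lemma eisensteinG_smul (γ : SL(2, ℤ)) (z : ℍ) : eisensteinG (γ • z) = eisensteinG z := by
  obtain ⟨F, hF, h⟩ := isEisensteinConstantTerm_eisensteinG (γ • z)
  exact IsEisensteinConstantTerm.unique
    ⟨F, fun s hs => (hF s hs).trans (eisensteinE_smul γ z s), h⟩
    (isEisensteinConstantTerm_eisensteinG z)

/-- `G` is bounded on the points whose orbit stays below a fixed height. -/
lemma exists_norm_eisensteinG_le_of_orbit (T : ℝ) :
    ∃ K : ℝ, 0 < K ∧ ∀ z : ℍ, (∀ γ : SL(2, ℤ), (γ • z).im ≤ T) → ‖eisensteinG z‖ ≤ K := by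
  obtain ⟨K, hK0, hK⟩ := exists_norm_eisensteinG_le T
  refine ⟨K, hK0, fun z hz => ?_⟩
  obtain ⟨γ, hγ⟩ := ModularGroup.exists_smul_mem_fd z
  rw [← eisensteinG_smul γ z]
  exact hK _ hγ (hz γ)

/-! ### Counting residues whose lattice has short vectors -/

/-- The lattice `{(u, v) : v ≡ u j mod M}` contains a non-zero vector whose coordinates are at most
`√(M / 6)` in absolute value. -/
def HasShortVector (M j : ℕ) : Prop :=
  ∃ u v : ℤ, (u ≠ 0 ∨ v ≠ 0) ∧ 6 * u ^ 2 ≤ M ∧ 6 * v ^ 2 ≤ M ∧ (M : ℤ) ∣ v - u * j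

/-- Up to sign only `u = 0` needs excluding: then `M ∣ v` with `v ≠ 0`, too large for `6 v² ≤ M`. -/
lemma HasShortVector.exists_pos {M j : ℕ} (hM : 0 < M) (h : HasShortVector M j) :
    ∃ u v : ℤ, 0 < u ∧ 6 * u ^ 2 ≤ M ∧ 6 * v ^ 2 ≤ M ∧ (M : ℤ) ∣ v - u * j := by
  obtain ⟨u, v, h0, hu, hv, hd⟩ := h
  rcases lt_trichotomy u 0 with h | rfl | h
  · refine ⟨-u, -v, by omega, by simpa using hu, by simpa using hv, ?_⟩
    rw [show -v - -u * (j : ℤ) = -(v - u * j) by ring]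
    exact hd.neg_right
  · have hv0 : v ≠ 0 := by simpa using h0
    rw [zero_mul, sub_zero] at hd
    have h1 := Int.le_of_dvd (abs_pos.2 hv0) ((dvd_abs _ _).2 hd)
    have hM' : (0 : ℤ) < M := by exact_mod_cast hM
    rw [← sq_abs] at hv
    nlinarith
  · exact ⟨u, v, h, hu, hv, hd⟩

-- Each admissible pair `(u, v)` with `1 ≤ u ≤ r`, `|v| ≤ r` serves at most one residue `j`, because
-- `u < M` is invertible modulo the prime `M`.
open scoped Classical in
lemma two_mul_card_hasShortVector_le {M : ℕ} (hM : M.Prime) :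
    2 * ((Finset.range M).filter (HasShortVector M)).card ≤ M := by
  set r := Nat.sqrt (M / 6) with hr
  have hrM : 6 * r ^ 2 ≤ M := by
    have := Nat.sqrt_le' (M / 6)
    rw [← hr] at this
    omega
  have hle : ∀ u : ℤ, 6 * u ^ 2 ≤ M → |u| ≤ r := by
    intro u hu
    rw [Int.abs_eq_natAbs]
    have : u.natAbs ^ 2 ≤ M / 6 := by
      rw [← Int.natAbs_sq] at hu
      have : 6 * u.natAbs ^ 2 ≤ M := by exact_mod_cast hu
      omega
    exact_mod_cast Nat.le_sqrt'.2 this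
  have hcard : ((Finset.range M).filter (HasShortVector M)).card ≤
      (Finset.Icc (1 : ℤ) r ×ˢ Finset.Icc (-r : ℤ) r).card := by
    refine Finset.card_le_card_of_forall_subsingleton
      (fun (j : ℕ) (p : ℤ × ℤ) => (M : ℤ) ∣ p.2 - p.1 * j) (fun j hj => ?_) fun p hp i hi j hj => ?_
    · obtain ⟨u, v, h0, hu, hv, hd⟩ := (Finset.mem_filter.1 hj).2.exists_pos hM.pos
      refine ⟨(u, v), ?_, hd⟩
      have h1 := abs_le.1 (hle u hu)
      have h2 := abs_le.1 (hle v hv)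
      simp only [Finset.mem_product, Finset.mem_Icc]
      omega
    · have hiM := Finset.mem_range.1 (Finset.mem_filter.1 hi.1).1
      have hjM := Finset.mem_range.1 (Finset.mem_filter.1 hj.1).1
      simp only [Finset.mem_product, Finset.mem_Icc] at hp
      have hd : (M : ℤ) ∣ p.1 * ((j : ℤ) - i) := by
        have := dvd_sub hi.2 hj.2
        rwa [show p.2 - p.1 * (i : ℤ) - (p.2 - p.1 * j) = p.1 * ((j : ℤ) - i) by ring] at this
      rcases (Nat.prime_iff_prime_int.1 hM).dvd_or_dvd hd with h | h
      · have h1 := Int.le_of_dvd (by omega) h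
        have h2 : (r : ℤ) < M := by
          have : r < M := by nlinarith [hM.pos]
          exact_mod_cast this
        omega
      · have := Int.eq_zero_of_abs_lt_dvd h (by rw [abs_lt]; omega)
        omega
  rw [Finset.card_product, Int.card_Icc, Int.card_Icc] at hcard
  have h1 : ((r : ℤ) + 1 - 1).toNat = r := by omega
  have h2 : ((r : ℤ) + 1 - -r).toNat = 2 * r + 1 := by omega
  rw [h1, h2] at hcard
  -- For `r ≥ 1`, `2 r (2 r + 1) ≤ 6 r² ≤ M`; this is where the constant `6` is used.
  rcases Nat.eq_zero_or_pos r with h0 | h0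
  · rw [h0] at hcard
    omega
  · nlinarith

/-! ### The height of the dilated points -/

/-- The point `M z`. -/
noncomputable def dilatePoint (M : ℕ) [NeZero M] (z : ℍ) : ℍ :=
  (⟨(M : ℝ), Nat.cast_pos.2 (NeZero.pos M)⟩ : {x : ℝ // 0 < x}) • z

lemma coe_dilatePoint (M : ℕ) [NeZero M] (z : ℍ) : (dilatePoint M z : ℂ) = M * z := by
  simp [dilatePoint]

lemma im_dilatePoint (M : ℕ) [NeZero M] (z : ℍ) : (dilatePoint M z).im = M * z.im := by
  simp [dilatePoint]

lemma measurable_dilatePoint (M : ℕ) [NeZero M] : Measurable (dilatePoint M) := by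
  rw [UpperHalfPlane.measurableEmbedding_coe.measurable_comp_iff.symm]
  have : UpperHalfPlane.coe ∘ dilatePoint M = fun z : ℍ => (M : ℂ) * (z : ℂ) :=
    funext (coe_dilatePoint M)
  rw [this]
  fun_prop

/-- If `(c, d)` is the bottom row of `h`, the automorphy factors of `h` at `M γ z` and of `γ` at `z`
multiply to `u z + v` with `(u, v) = (c M, d) γ`. -/
lemma im_smul_dilatePoint_smul (M : ℕ) [NeZero M] (h γ : SL(2, ℤ)) (z : ℍ) {u v : ℤ}
    (hu : u = Matrix.vecMul ![h 1 0 * M, h 1 1] γ.1 0)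
    (hv : v = Matrix.vecMul ![h 1 0 * M, h 1 1] γ.1 1) :
    (u : ℂ) * z + v ≠ 0 ∧
      (h • dilatePoint M (γ • z)).im = M * z.im / Complex.normSq ((u : ℂ) * z + v) := by
  have hd := UpperHalfPlane.denom_ne_zero γ z
  have hd' := UpperHalfPlane.denom_ne_zero h (dilatePoint M (γ • z))
  have hkey : UpperHalfPlane.denom h (dilatePoint M (γ • z)) =
      ((u : ℂ) * z + v) / UpperHalfPlane.denom γ z := by
    have := denom_mul_smul γ z ![h 1 0 * M, h 1 1]
    rw [← hu, ← hv] at this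
    rw [← this]
    simp [UpperHalfPlane.denom, coe_dilatePoint, mul_assoc]
  have hne : (u : ℂ) * z + v ≠ 0 := by
    intro h0
    rw [hkey, h0, zero_div] at hd'
    exact hd' rfl
  refine ⟨hne, ?_⟩
  have hn := Complex.normSq_pos.2 hd
  rw [ModularGroup.im_smul_eq_div_normSq, hkey, im_dilatePoint,
    ModularGroup.im_smul_eq_div_normSq, Complex.normSq_div]
  field_simp

/-- Modulo `M` the first entry of `(c M, d) g` vanishes, and `S T ^ j` sends a row `(a, b)` to `(b,
b j - a)`. -/
lemma dvd_of_mem_Gamma0 {M : ℕ} {g : SL(2, ℤ)} (hg : g ∈ Gamma0 M) (j : ℕ) (c d : ℤ) :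
    (M : ℤ) ∣ Matrix.vecMul ![c * M, d] (g * (ModularGroup.S * ModularGroup.T ^ j)).1 1 -
      Matrix.vecMul ![c * M, d] (g * (ModularGroup.S * ModularGroup.T ^ j)).1 0 * j := by
  have hg' : (M : ℤ) ∣ g 1 0 := by
    rw [Gamma0_mem] at hg
    exact (ZMod.intCast_zmod_eq_zero_iff_dvd _ _).1 hg
  have hT : (ModularGroup.T ^ j).1 = !![1, (j : ℤ); 0, 1] := by
    rw [← zpow_natCast, ModularGroup.coe_T_zpow]
  have : Matrix.vecMul ![c * M, d] (g * (ModularGroup.S * ModularGroup.T ^ j)).1 1 -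
      Matrix.vecMul ![c * M, d] (g * (ModularGroup.S * ModularGroup.T ^ j)).1 0 * j =
      -(c * M * g 0 0 + d * g 1 0) := by
    simp [Matrix.SpecialLinearGroup.coe_mul, hT, ModularGroup.coe_S, Matrix.vecMul,
      Matrix.vecHead, Matrix.vecTail, Matrix.mul_apply, Fin.sum_univ_two]
    ring
  rw [this]
  exact (dvd_add ((dvd_mul_left _ _).mul_right _) (hg'.mul_left _)).neg_right

lemma im_smul_dilatePoint_le {M : ℕ} [NeZero M] {Y : ℝ} (hY : 1 ≤ Y) {g : SL(2, ℤ)}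
    (hg : g ∈ Gamma0 M) {j : ℕ} (hj : ¬ HasShortVector M j) {z : ℍ} (hz : z ∈ 𝒟) (hzY : z.im ≤ Y)
    (h : SL(2, ℤ)) :
    (h • dilatePoint M ((g * (ModularGroup.S * ModularGroup.T ^ j)) • z)).im ≤ 18 * Y := by
  by_contra! hlt
  obtain ⟨hne, him⟩ := im_smul_dilatePoint_smul M h _ z rfl rfl
  have hdvd := dvd_of_mem_Gamma0 hg j (h 1 0) (h 1 1)
  rw [him] at hlt
  generalize Matrix.vecMul ![h 1 0 * M, h 1 1]
    (g * (ModularGroup.S * ModularGroup.T ^ j)).1 0 = u at *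
  generalize Matrix.vecMul ![h 1 0 * M, h 1 1]
    (g * (ModularGroup.S * ModularGroup.T ^ j)).1 1 = v at *
  rw [lt_div_iff₀ (Complex.normSq_pos.2 hne)] at hlt
  have hy : 1 / 2 ≤ z.im := (fd_subset_verticalStrip hz).2
  have hx := abs_le.1 hz.2
  have hns : Complex.normSq ((u : ℂ) * z + v) = (u * z.re + v) ^ 2 + (u * z.im) ^ 2 := by
    simp [Complex.normSq_apply]
    ring
  rw [hns] at hlt
  have hM : (0 : ℝ) < M := Nat.cast_pos.2 (NeZero.pos M)
  -- A height above `18 Y` means `18 Y ((u x + v)² + (u y)²) < M y`. Dropping either square and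
  -- using `1 / 2 ≤ y ≤ Y` bounds `u²` by `M / 9` and `(u x + v)²` by `M / 18`.
  have h1 : 18 * Y * ((u : ℝ) ^ 2 * z.im) < M := by
    refine lt_of_mul_lt_mul_right ?_ z.im_pos.le
    nlinarith [mul_nonneg (by linarith : 0 ≤ 18 * Y) (sq_nonneg (u * z.re + v : ℝ))]
  have h2 : 9 * Y * (u : ℝ) ^ 2 < M := by
    nlinarith [mul_nonneg (mul_nonneg (by linarith : 0 ≤ Y) (sq_nonneg (u : ℝ)))
      (by linarith : 0 ≤ z.im - 1 / 2)]
  have h3 : 18 * (u * z.re + v : ℝ) ^ 2 < M := by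
    have : 18 * Y * (u * z.re + v : ℝ) ^ 2 < M * Y := by
      nlinarith [mul_nonneg (by linarith : 0 ≤ 18 * Y) (sq_nonneg (u * z.im : ℝ)),
        mul_le_mul_of_nonneg_left hzY hM.le]
    refine lt_of_mul_lt_mul_right (a := Y) ?_ (by linarith)
    linarith
  have h4 : 9 * (u : ℝ) ^ 2 < M := by nlinarith [sq_nonneg (u : ℝ)]
  -- From `v = (u x + v) - u x` and `|x| ≤ 1 / 2`; hence `v² < M / 9 + M / 18 = M / 6`.
  have h5 : (v : ℝ) ^ 2 ≤ 2 * (u * z.re + v : ℝ) ^ 2 + (u : ℝ) ^ 2 / 2 := by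
    have hx2 : z.re ^ 2 ≤ 1 / 4 := by nlinarith
    nlinarith [sq_nonneg (u * z.re + v + u * z.re : ℝ), mul_le_mul_of_nonneg_left hx2
      (sq_nonneg (u : ℝ))]
  refine hj ⟨u, v, ?_, ?_, ?_, hdvd⟩
  · by_contra! h0
    simp [h0.1, h0.2] at hne
  · have : 6 * (u : ℝ) ^ 2 ≤ M := by nlinarith [sq_nonneg (u : ℝ)]
    exact_mod_cast this
  · have : 6 * (v : ℝ) ^ 2 ≤ M := by linarith
    exact_mod_cast this

/-! ### Integrals against the test functions -/

lemma exists_mem_Gamma0_out_eq {M : ℕ} (γ : SL(2, ℤ)) :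
    ∃ g ∈ Gamma0 M, (⟦γ⟧ : RightCosets M).out = g * γ := by
  have h : (QuotientGroup.rightRel (Gamma0 M)) (⟦γ⟧ : RightCosets M).out γ := Quotient.mk_out γ
  rw [QuotientGroup.rightRel_apply] at h
  exact ⟨_, (Gamma0 M).inv_mem h, by group⟩

lemma testFunction_mul_left (φ₀ : ℍ → ℂ) {M : ℕ} {g : SL(2, ℤ)} (hg : g ∈ Gamma0 M)
    (γ : SL(2, ℤ)) : testFunction φ₀ M (g * γ) = testFunction φ₀ M γ := by
  ext z
  have : (∃ k ∈ Gamma0 M, ∃ w ∈ 𝒟, z = (k * (g * γ)) • w) ↔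
      ∃ k ∈ Gamma0 M, ∃ w ∈ 𝒟, z = (k * γ) • w := by
    constructor
    · rintro ⟨k, hk, w, hw, h⟩
      exact ⟨k * g, mul_mem hk hg, w, hw, by rw [h, mul_assoc]⟩
    · rintro ⟨k, hk, w, hw, h⟩
      exact ⟨k * g⁻¹, mul_mem hk (inv_mem hg), w, hw, by rw [h, mul_assoc, inv_mul_cancel_left]⟩
  classical exact if_congr this rfl rfl

lemma finite_testFunctions (φ₀ : ℍ → ℂ) (M : ℕ) [NeZero M] : (testFunctions φ₀ M).Finite := by
  refine (Set.finite_range fun q : RightCosets M => testFunction φ₀ M q.out).subset ?_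
  rintro _ ⟨γ, rfl⟩
  obtain ⟨g, hg, h⟩ := exists_mem_Gamma0_out_eq (M := M) γ
  exact ⟨⟦γ⟧, by simp only [h, testFunction_mul_left φ₀ hg]⟩

lemma IsBaseTestFunction.mem_of_ne_zero {φ₀ : ℍ → ℂ} {z : ℍ} (hz : z ∈ 𝒟) (h : φ₀ z ≠ 0) :
    z ∈ tsupport φ₀ ∩ 𝒟 :=
  ⟨subset_tsupport _ h, hz⟩

lemma IsBaseTestFunction.exists_ne_zero {φ₀ : ℍ → ℂ} (hφ : IsBaseTestFunction φ₀) :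
    ∃ z ∈ 𝒟, φ₀ z ≠ 0 := by
  obtain ⟨p, hp, -⟩ := hφ.connected.nonempty
  obtain ⟨w, hw⟩ : (Function.support φ₀).Nonempty := closure_nonempty_iff.1 ⟨p, hp⟩
  obtain ⟨γ, hγ⟩ := ModularGroup.exists_smul_mem_fd w
  exact ⟨γ • w, hγ, by rwa [hφ.invariant]⟩

-- Where `φ₀ z ≠ 0` the point `z` is interior to `𝒟`, so if `q.out • z` also lies in `g γ 𝒟`, the
-- two matrices agree up to sign. Since `-1 ∈ Γ_0(M)`, the cosets coincide.
open scoped Classical in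
lemma IsBaseTestFunction.testFunction_out_smul {φ₀ : ℍ → ℂ} (hφ : IsBaseTestFunction φ₀) {M : ℕ}
    (γ : SL(2, ℤ)) (q : RightCosets M) {z : ℍ} (hz : z ∈ 𝒟) :
    testFunction φ₀ M γ (q.out • z) = if q = ⟦γ⟧ then φ₀ z else 0 := by
  split_ifs with hq
  · subst hq
    obtain ⟨g, hg, h⟩ := exists_mem_Gamma0_out_eq (M := M) γ
    rw [testFunction, if_pos ⟨g, hg, z, hz, by rw [h]⟩, hφ.invariant]
  · rw [testFunction, hφ.invariant]
    refine ite_eq_right_iff.2 ?_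
    rintro ⟨g, hg, w, hw, h⟩
    by_contra h0
    apply hq
    have hzo : z ∈ 𝒟ᵒ := hφ.interior (mem_of_ne_zero hz h0)
    have hw' : ((g * γ)⁻¹ * q.out) • z = w := by rw [mul_smul, h, inv_smul_smul]
    rw [← q.out_eq]
    refine Quotient.sound ?_
    change QuotientGroup.rightRel (Gamma0 M) _ _
    rw [QuotientGroup.rightRel_apply]
    rcases ModularGroup.eq_one_or_neg_one_of_mem_fdo_mem_fd hzo (hw' ▸ hw) with h1 | h1
    · rw [inv_mul_eq_one.1 h1 |>.symm]
      simpa using hg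
    · rw [inv_mul_eq_iff_eq_mul.1 h1]
      have : γ * (g * γ * -1)⁻¹ = -g⁻¹ := by
        rw [mul_neg_one, inv_neg, mul_inv_rev, mul_neg, mul_inv_cancel_left]
      have hg' : g⁻¹ ∈ Gamma0 M := inv_mem hg
      rw [Gamma0_mem] at hg'
      rw [this, Gamma0_mem, show (-g⁻¹).1 1 0 = -(g⁻¹).1 1 0 from rfl, Int.cast_neg, hg',
        neg_zero]

/-- Evaluation at the translate of a point of `𝒟` where `φ₀ ≠ 0` recovers the coset; distinct cosets
are thus counted as distinct test functions. -/
lemma IsBaseTestFunction.mk_eq_of_testFunction_eq {φ₀ : ℍ → ℂ} (hφ : IsBaseTestFunction φ₀) {M : ℕ}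
    {γ₁ γ₂ : SL(2, ℤ)} (h : testFunction φ₀ M γ₁ = testFunction φ₀ M γ₂) :
    (⟦γ₁⟧ : RightCosets M) = ⟦γ₂⟧ := by
  obtain ⟨z, hz, h0⟩ := hφ.exists_ne_zero
  have h1 := congrFun h ((⟦γ₁⟧ : RightCosets M).out • z)
  rw [hφ.testFunction_out_smul _ _ hz, hφ.testFunction_out_smul _ _ hz, if_pos rfl] at h1
  by_contra hne
  rw [if_neg hne] at h1
  exact h0 h1

lemma measurableSet_fd : MeasurableSet 𝒟 := ModularGroup.isClosed_fd.measurableSet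

lemma IsBaseTestFunction.integrableOn {φ₀ : ℍ → ℂ} (hφ : IsBaseTestFunction φ₀) :
    IntegrableOn φ₀ 𝒟 := by
  refine IntegrableOn.of_forall_sdiff_eq_zero
    (hφ.smooth.continuous.continuousOn.integrableOn_compact hφ.compact) measurableSet_fd
    fun z hz => ?_
  by_contra h0
  exact hz.2 (mem_of_ne_zero hz.1 h0)

lemma IsBaseTestFunction.integrableOn_mul {φ₀ : ℍ → ℂ} (hφ : IsBaseTestFunction φ₀)
    {f : ℍ → ℂ} (hf : Measurable f) {K : ℝ} (hK : ∀ z ∈ 𝒟, φ₀ z ≠ 0 → ‖f z‖ ≤ K) :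
    IntegrableOn (fun z => f z * conj (φ₀ z)) 𝒟 ∧
      ‖∫ z in 𝒟, f z * conj (φ₀ z)‖ ≤ K * normL1 φ₀ := by
  have hle : ∀ z ∈ 𝒟, ‖f z * conj (φ₀ z)‖ ≤ K * ‖φ₀ z‖ := by
    intro z hz
    rw [norm_mul, RCLike.norm_conj]
    by_cases h0 : φ₀ z = 0
    · simp [h0]
    · exact mul_le_mul_of_nonneg_right (hK z hz h0) (norm_nonneg _)
  have hint : IntegrableOn (fun z => K * ‖φ₀ z‖) 𝒟 := hφ.integrableOn.norm.const_mul K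
  have hae := (ae_restrict_mem (μ := volume) measurableSet_fd).mono hle
  have hm : Measurable fun z => f z * conj (φ₀ z) :=
    hf.mul (Complex.continuous_conj.comp hφ.smooth.continuous).measurable
  refine ⟨hint.mono' hm.aestronglyMeasurable hae, ?_⟩
  rw [normL1, ← integral_const_mul]
  exact norm_integral_le_of_norm_le hint hae

/-- Only the coset of `γ` contributes to the integral over `Y_0(M)`, so a bound for `f` on that
translate of the support suffices. -/
lemma IsBaseTestFunction.innerY0_testFunction {φ₀ : ℍ → ℂ} (hφ : IsBaseTestFunction φ₀) {M : ℕ}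
    (γ : SL(2, ℤ)) {f : ℍ → ℂ} (hf : Measurable f) {K : ℝ}
    (hK : ∀ z ∈ 𝒟, φ₀ z ≠ 0 → ‖f ((⟦γ⟧ : RightCosets M).out • z)‖ ≤ K) :
    IntegrableY0 M (fun z => f z * conj (testFunction φ₀ M γ z)) ∧
      ‖innerY0 M f (testFunction φ₀ M γ)‖ ≤ K * normL1 φ₀ := by
  have hsmul : Measurable fun z : ℍ => (⟦γ⟧ : RightCosets M).out • z :=
    (continuous_const_smul ((⟦γ⟧ : RightCosets M).out : GL (Fin 2) ℝ)).measurable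
  obtain ⟨h1, h2⟩ := hφ.integrableOn_mul (hf.comp hsmul) hK
  have heq : Set.EqOn (fun z => f ((⟦γ⟧ : RightCosets M).out • z) *
      conj (testFunction φ₀ M γ ((⟦γ⟧ : RightCosets M).out • z)))
      (fun z => f ((⟦γ⟧ : RightCosets M).out • z) * conj (φ₀ z)) 𝒟 := fun z hz => by
    simp only [hφ.testFunction_out_smul γ _ hz, if_true]
  have hne : ∀ q : RightCosets M, q ≠ ⟦γ⟧ →
      Set.EqOn (fun z => f (q.out • z) * conj (testFunction φ₀ M γ (q.out • z))) 0 𝒟 :=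
    fun q hq z hz => by
      simp only [hφ.testFunction_out_smul γ _ hz, if_neg hq, map_zero, mul_zero, Pi.zero_apply]
  constructor
  · intro q
    rcases eq_or_ne q ⟦γ⟧ with rfl | hq
    · exact h1.congr_fun heq.symm measurableSet_fd
    · exact integrableOn_zero.congr_fun (hne q hq).symm measurableSet_fd
  · rw [innerY0, integralY0, finsum_eq_single _ (⟦γ⟧ : RightCosets M) fun q hq => by
      rw [setIntegral_congr_fun measurableSet_fd (hne q hq)]; simp,
      setIntegral_congr_fun measurableSet_fd heq]
    exact h2

/-- The quotient `S T ^ j (S T ^ i)⁻¹` has lower left entry `i - j`, divisible by `M` only when `i =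
j`. -/
lemma eq_of_mk_S_mul_T_pow_eq {M i j : ℕ} (hi : i < M) (hj : j < M)
    (h : (⟦ModularGroup.S * ModularGroup.T ^ i⟧ : RightCosets M) =
      ⟦ModularGroup.S * ModularGroup.T ^ j⟧) : i = j := by
  have h1 : QuotientGroup.rightRel (Gamma0 M) _ _ := Quotient.exact h
  rw [QuotientGroup.rightRel_apply] at h1
  have hT : ∀ k : ℕ, (ModularGroup.T ^ k).1 = !![1, (k : ℤ); 0, 1] := fun k => by
    rw [← zpow_natCast, ModularGroup.coe_T_zpow]
  rw [Gamma0_mem, ZMod.intCast_zmod_eq_zero_iff_dvd] at h1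
  have h2 : (ModularGroup.S * ModularGroup.T ^ j * (ModularGroup.S * ModularGroup.T ^ i)⁻¹).1 1 0 =
      (i : ℤ) - j := by
    rw [Matrix.SpecialLinearGroup.coe_mul, Matrix.SpecialLinearGroup.coe_inv,
      Matrix.SpecialLinearGroup.coe_mul, Matrix.SpecialLinearGroup.coe_mul, hT, hT,
      ModularGroup.coe_S]
    simp [Matrix.adjugate_fin_two]
    ring
  rw [h2] at h1
  have := Int.eq_zero_of_abs_lt_dvd h1 (by rw [abs_lt]; omega)
  omega

/-- Removing the Euler factor at `M` gives `L(2, χ) = (1 - M⁻²) ζ(2)`, whence `c1 M = 1 / (M + 1)`.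
-/
lemma norm_c1_le (M : ℕ) [Fact M.Prime] : ‖c1 M‖ ≤ (M : ℝ)⁻¹ := by
  have hp : M.Prime := Fact.out
  have hL : DirichletCharacter.LFunction (1 : DirichletCharacter ℂ M) 2 =
      (1 - ((M : ℂ) ^ 2)⁻¹) * riemannZeta 2 := by
    have := DirichletCharacter.LFunctionTrivChar_eq_mul_riemannZeta (N := M) (s := 2) (by norm_num)
    rw [DirichletCharacter.LFunctionTrivChar, hp.primeFactors, Finset.prod_singleton,
      Complex.cpow_neg] at this
    rw [this]
    norm_cast
  have hM : (1 : ℝ) < M := by exact_mod_cast hp.one_lt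
  have hM0 : (M : ℂ) ≠ 0 := by exact_mod_cast hp.ne_zero
  have hreal : c1 M = (((M : ℝ) + 1)⁻¹ : ℝ) := by
    have h1 : (M : ℂ) + 1 ≠ 0 := by exact_mod_cast (by positivity : (M : ℝ) + 1 ≠ 0)
    have h2 : (M : ℂ) - 1 ≠ 0 := by exact_mod_cast (by linarith : (M : ℝ) - 1 ≠ 0)
    have h3 : (M : ℂ) ^ 2 - 1 ≠ 0 := by
      rw [show (M : ℂ) ^ 2 - 1 = (M + 1) * (M - 1) by ring]
      exact mul_ne_zero h1 h2
    have hz := zeta_two_ne_zero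
    rw [c1, hL]
    push_cast
    field_simp
    ring
  rw [hreal, Complex.norm_real, Real.norm_eq_abs, abs_of_pos (by positivity)]
  exact inv_anti₀ (by linarith) (by linarith)

end ShrinkingQUE

open ShrinkingQUE in
theorem theorem1p5 :
    (∀ z : ℍ, IsEisensteinConstantTerm z (eisensteinG z)) ∧
    ∃ δ : ℝ, 0 < δ ∧ ∀ Y : ℝ, ∃ C : ℝ, 0 < C ∧
      ∀ φ₀ : ℍ → ℂ, IsBaseTestFunction φ₀ → (∀ z ∈ tsupport φ₀ ∩ 𝒟, z.im ≤ Y) →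
        ∀ (M : ℕ) [Fact M.Prime],
          δ * (M : ℝ) ≤ (({φ ∈ testFunctions φ₀ M |
            IntegrableY0 M (fun z => eisensteinG z * conj (φ z)) ∧
            IntegrableY0 M (fun z => dilate M eisensteinG z * conj (φ z)) ∧
            ‖c1 M‖ * ‖innerY0 M eisensteinG φ‖ +
                ‖cM M‖ * ‖innerY0 M (dilate M eisensteinG) φ‖
              ≤ C * (M : ℝ)⁻¹ * normL1 φ₀}.ncard : ℕ) : ℝ) := by
  classical
  refine ⟨isEisensteinConstantTerm_eisensteinG, 1 / 2, by norm_num, fun Y => ?_⟩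
  obtain ⟨K₁, hK₁0, hK₁⟩ := exists_norm_eisensteinG_le Y
  -- The height estimate needs a bound that is at least `1`, hence `max Y 1`.
  obtain ⟨K₂, hK₂0, hK₂⟩ := exists_norm_eisensteinG_le_of_orbit (18 * max Y 1)
  refine ⟨K₁ + K₂, by positivity, fun φ₀ hφ hY M hM => ?_⟩
  have hbad := two_mul_card_hasShortVector_le hM.out
  have hcard := Finset.card_filter_add_card_filter_not (s := Finset.range M) (HasShortVector M)
  rw [Finset.card_range] at hcard
  set good := (Finset.range M).filter fun j => ¬ HasShortVector M j with hgood
  have hinj : Set.InjOn (fun j => testFunction φ₀ M (ModularGroup.S * ModularGroup.T ^ j))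
      (good : Set ℕ) := fun i hi j hj h =>
    eq_of_mk_S_mul_T_pow_eq (Finset.mem_range.1 (Finset.mem_filter.1 hi).1)
      (Finset.mem_range.1 (Finset.mem_filter.1 hj).1) (hφ.mk_eq_of_testFunction_eq h)
  have hhalf : (1 / 2 : ℝ) * M ≤ (good.card : ℝ) := by
    have : M ≤ 2 * good.card := by omega
    have : (M : ℝ) ≤ 2 * good.card := by exact_mod_cast this
    linarith
  refine hhalf.trans (Nat.cast_le.2 ?_)
  rw [← Set.ncard_coe_finset, ← hinj.ncard_image]
  refine Set.ncard_le_ncard ?_ ((finite_testFunctions φ₀ M).subset fun φ h => h.1)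
  rintro _ ⟨j, hj, rfl⟩
  have hjs : ¬ HasShortVector M j := (Finset.mem_filter.1 hj).2
  have hzY : ∀ z ∈ 𝒟, φ₀ z ≠ 0 → z.im ≤ Y := fun z hz h0 =>
    hY z (IsBaseTestFunction.mem_of_ne_zero hz h0)
  obtain ⟨h1, h2⟩ := hφ.innerY0_testFunction (M := M) (ModularGroup.S * ModularGroup.T ^ j)
    measurable_eisensteinG (K := K₁) fun z hz h0 => by
      rw [eisensteinG_smul]
      exact hK₁ z hz (hzY z hz h0)
  obtain ⟨h3, h4⟩ := hφ.innerY0_testFunction (M := M) (ModularGroup.S * ModularGroup.T ^ j)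
    (f := dilate M eisensteinG) (measurable_eisensteinG.comp (measurable_dilatePoint M)) (K := K₂)
    fun z hz h0 => by
      obtain ⟨g, hg, hout⟩ :=
        exists_mem_Gamma0_out_eq (M := M) (ModularGroup.S * ModularGroup.T ^ j)
      rw [hout]
      -- The chosen representative differs from `S T ^ j` by some `g ∈ Γ_0(M)`, which preserves the
      -- congruence `v ≡ u j`.
      exact hK₂ _ fun h => im_smul_dilatePoint_le (le_max_right Y 1) hg hjs hz
        ((hzY z hz h0).trans (le_max_left Y 1)) h
  refine ⟨⟨_, rfl⟩, h1, h3, ?_⟩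
  have hc := norm_c1_le M
  have hM0 : (0 : ℝ) ≤ (M : ℝ)⁻¹ := by positivity
  calc _ ≤ (M : ℝ)⁻¹ * (K₁ * normL1 φ₀) + (M : ℝ)⁻¹ * (K₂ * normL1 φ₀) :=
        add_le_add (mul_le_mul hc h2 (norm_nonneg _) hM0)
          (mul_le_mul hc h4 (norm_nonneg _) hM0)
    _ = _ := by ring
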